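/- **Theorem (High-Dimensional, Sub-Gaussian Entries).** There is an absolute constant $C>0$ such that the following holds. Let $d\ge n$ and let $X\in\mathbb{R}^{n\times d}$ be a random matrix whose rows $\mathbf{x}_1^\top,\dots,\mathbf{x}_n^\top$ are i.i.d. mean-zero random vectors with finite second moments. Let $\Sigma:=\mathbb{E}\left[\frac1n X^\top X\right]\in\mathbb{R}^{d\times d}$, assume that $\Sigma$ is invertible, and let $\hat\Sigma:=\frac1n X^\top X$. For $K\in\mathbb{R}$, assume that the entries $z_{ij}$ $(1\le i\le n,\ 1\le j\le d)$ of the vectors $\mathbf{z}_i:=\Sigma^{-1/2}\mathbf{x}_i$ are independent random variables with variance $1$ and sub-gaussian norm $$\|z_{ij}\|_{\psi_2}:=\sup_{p\ge 1}\frac{1}{\sqrt p}\,\bigl(\mathbb{E}|z_{ij}|^p\bigr)^{1/p}\le K .$$ Then for every $t\ge 0$, with probability at least $1-2\exp(-t^2)$, it holds simultaneously for all $i\in\{1,\dots,n\}$ that $$\lambda_{i+d-n}(\Sigma)\left(1-CK^2\max(\epsilon,\epsilon^2)\right)\le \frac nd\,\lambda_i(\hat\Sigma)\le \lambda_i(\Sigma)\left(1+CK^2\max(\epsilon,\epsilon^2)\right),\qquad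 \epsilon:=\sqrt{\frac nd}+\frac{t}{\sqrt d},$$ where $\lambda_1(A)\ge\lambda_2(A)\ge\dots\ge\lambda_d(A)$ are the eigenvalues of a symmetric matrix $A\in\mathbb{R}^{d\times d}$, counted with multiplicity. -/

import Mathlib

open MeasureTheory ProbabilityTheory
open scoped ENNReal MatrixOrder

noncomputable section

/-- The sub-gaussian norm `sup_{p ≥ 1} p^{-1/2} (E |Y|^p)^{1/p}` of a real random variable,
as an extended nonnegative number; `Y` is sub-gaussian when it is finite. -/
def subgaussianNorm {Ω : Type*} [MeasurableSpace Ω] (Y : Ω → ℝ) (P : Measure Ω) : ℝ≥0∞ :=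
  ⨆ (p : ℝ) (_ : 1 ≤ p), eLpNorm Y (ENNReal.ofReal p) P / ENNReal.ofReal (Real.sqrt p)

/-- The `n × d` matrix whose rows are the given vectors, at the sample point `ω`. -/
def dataMatrix {Ω : Type*} {n d : ℕ} (x : Fin n → Ω → Fin d → ℝ) (ω : Ω) :
    Matrix (Fin n) (Fin d) ℝ :=
  Matrix.of fun i j => x i ω j

/-- The empirical second-moment matrix `(1/n) Xᵀ X`. -/
def empiricalCov {Ω : Type*} {n d : ℕ} (x : Fin n → Ω → Fin d → ℝ) (ω : Ω) :
    Matrix (Fin d) (Fin d) ℝ :=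
  (1 / (n : ℝ)) • ((dataMatrix x ω).transpose * dataMatrix x ω)

/-- The second-moment matrix `E[(1/n) Xᵀ X]`, the expectation being taken entrywise. -/
def populationCov {Ω : Type*} [MeasurableSpace Ω] {n d : ℕ} (x : Fin n → Ω → Fin d → ℝ)
    (P : Measure Ω) : Matrix (Fin d) (Fin d) ℝ :=
  Matrix.of fun j k => ∫ ω, empiricalCov x ω j k ∂P

/-- The whitened vector `z_i = Σ^{-1/2} x_i`, where `Σ = E[(1/n) Xᵀ X]` and `Σ^{1/2}` is the
positive semidefinite square root. -/
def whitened {Ω : Type*} [MeasurableSpace Ω] {n d : ℕ} (x : Fin n → Ω → Fin d → ℝ)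
    (P : Measure Ω) (i : Fin n) (ω : Ω) : Fin d → ℝ :=
  (CFC.sqrt (populationCov x P))⁻¹.mulVec (x i ω)

theorem empiricalCov_isHermitian {Ω : Type*} {n d : ℕ} (x : Fin n → Ω → Fin d → ℝ) (ω : Ω) :
    (empiricalCov x ω).IsHermitian := by
  simp [Matrix.IsHermitian, empiricalCov, Matrix.conjTranspose_eq_transpose_of_trivial,
    Matrix.transpose_smul, Matrix.transpose_mul]

theorem populationCov_isHermitian {Ω : Type*} [MeasurableSpace Ω] {n d : ℕ}
    (x : Fin n → Ω → Fin d → ℝ) (P : Measure Ω) : (populationCov x P).IsHermitian := by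
  ext j k
  have h : ∀ ω, empiricalCov x ω k j = empiricalCov x ω j k := fun ω => by
    simpa using (empiricalCov_isHermitian x ω).apply j k
  simp [populationCov, h]

/-- The eigenvalues of a real symmetric matrix, with multiplicity, in nonincreasing order.
Indices start at `0`: the usual `λ_i` is `sortedEigenvalue hA (i - 1)`. -/
def sortedEigenvalue {d : ℕ} {A : Matrix (Fin d) (Fin d) ℝ} (hA : A.IsHermitian)
    (i : Fin d) : ℝ :=
  hA.eigenvalues₀ (Fin.cast (Fintype.card_fin d).symm i)

end

/-! Write `X = Z S` with `S = Σ^{1/2}`; the entries of `Z` are independent, centred, of unit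
variance and sub-Gaussian. Since `d ≥ n`, the tall matrix `Zᵀ` should be nearly `√d` times an
isometry: `|‖Zᵀa‖² - d‖a‖²| ≤ d r ‖a‖²` for all `a`, where `r = C K² max(ε, ε²)`.

The rest is deterministic (`sortedEigenvalue_bounds_of_near_isometry`). The bound `‖Z‖² ≤ d(1+r)`
gives `(n/d) Σ̂ ≤ (1+r) Σ` as quadratic forms, hence the upper estimates. As `Σ̂` has rank at most
`n`, the reverse comparison can only hold on a subspace, here the `n`-dimensional `S⁻¹(range Zᵀ)`.
Restricting min-max to it costs the index shift by `d - n`.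

For a fixed unit vector `a`, `‖Zᵀa‖²` is a sum of `d` independent squares of sub-Gaussian variables,
so Bernstein's inequality gives the near-isometry at `a` up to probability `2 exp(-2dε²)`. A net of
at most `5^n ≤ e^{2n}` points makes this uniform in `a`, because `dε² = (√n + t)² ≥ n + t²`. -/

/-! ### Spectral decomposition and min-max comparison of eigenvalues. -/

open Matrix in
/-- Spectral theorem with the eigenvalues in nonincreasing order. -/
theorem exists_orthogonal_diagonalization {d : ℕ} {A : Matrix (Fin d) (Fin d) ℝ}
    (hA : A.IsHermitian) :
    ∃ U : Matrix (Fin d) (Fin d) ℝ, U * Uᵀ = 1 ∧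
      A = Uᵀ * diagonal (sortedEigenvalue hA) * U := by
  -- `eigenvalues` is `eigenvalues₀` transported along an unspecified bijection; `e` undoes it, so
  -- that the rows of `U` follow the sorted order.
  let e : Fin d ≃ Fin d :=
    (finCongr (Fintype.card_fin d).symm).trans (Fintype.equivOfCardEq (Fintype.card_fin _))
  have he : ∀ i, hA.eigenvalues (e i) = sortedEigenvalue hA i := by
    intro i
    simp [e, Matrix.IsHermitian.eigenvalues, sortedEigenvalue, finCongr]
  let V : Matrix (Fin d) (Fin d) ℝ := hA.eigenvectorUnitary
  have hV : Vᵀ * V = 1 := by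
    have := (Matrix.mem_unitaryGroup_iff').1 hA.eigenvectorUnitary.2
    simpa [V, star_eq_conjTranspose, conjTranspose_eq_transpose_of_trivial] using this
  have hs := hA.spectral_theorem
  rw [Unitary.conjStarAlgAut_apply] at hs
  refine ⟨Vᵀ.submatrix e id, ?_, ?_⟩
  · rw [transpose_submatrix, transpose_transpose, ← submatrix_mul _ _ e id e Function.bijective_id,
      hV]
    simp
  · have hD : diagonal (sortedEigenvalue hA) = (diagonal hA.eigenvalues).submatrix e e := by
      rw [submatrix_diagonal _ _ e.injective]; congr 1; ext i; simp [he]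
    rw [hD, transpose_submatrix, transpose_transpose, ← submatrix_mul _ _ id e e e.bijective,
      ← submatrix_mul _ _ id e id e.bijective, submatrix_id_id]
    conv_lhs => rw [hs]
    simp [V, star_eq_conjTranspose, conjTranspose_eq_transpose_of_trivial]

theorem sortedEigenvalue_antitone {d : ℕ} {A : Matrix (Fin d) (Fin d) ℝ} (hA : A.IsHermitian) :
    Antitone (sortedEigenvalue hA) := fun _ _ hij => hA.eigenvalues₀_antitone (by simpa using hij)

open Matrix in
theorem dotProduct_self_mulVec_of_orthogonal {d : ℕ} {U : Matrix (Fin d) (Fin d) ℝ}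
    (hU : U * Uᵀ = 1) (v : Fin d → ℝ) : ∑ j, (U *ᵥ v) j ^ 2 = v ⬝ᵥ v := by
  have : (U *ᵥ v) ⬝ᵥ (U *ᵥ v) = v ⬝ᵥ v := by
    rw [dotProduct_mulVec, vecMul_mulVec, ← dotProduct_mulVec, mul_eq_one_comm.1 hU, one_mulVec]
  rw [← this]; simp [dotProduct, sq]

open Matrix in
theorem dotProduct_mulVec_of_diagonalization {d : ℕ} {U : Matrix (Fin d) (Fin d) ℝ}
    {l : Fin d → ℝ} {A : Matrix (Fin d) (Fin d) ℝ} (hA : A = Uᵀ * diagonal l * U)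
    (v : Fin d → ℝ) :
    v ⬝ᵥ A *ᵥ v = ∑ j, l j * (U *ᵥ v) j ^ 2 := by
  rw [hA, mul_assoc, ← mulVec_mulVec, dotProduct_mulVec, vecMul_transpose, ← mulVec_mulVec]
  simp only [dotProduct, mulVec_diagonal]
  exact Finset.sum_congr rfl fun j _ => by ring

open Matrix in
/-- Comparison of eigenvalues from a comparison of quadratic forms on an `n`-dimensional subspace. -/
theorem sortedEigenvalue_le_of_quadraticForm_le {n d : ℕ} (hnd : n ≤ d)
    {A B : Matrix (Fin d) (Fin d) ℝ} (hA : A.IsHermitian) (hB : B.IsHermitian)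
    (L : (Fin n → ℝ) →ₗ[ℝ] (Fin d → ℝ)) (hL : Function.Injective L) {c e : ℝ}
    (hc : 0 ≤ c) (he : 0 ≤ e) (h : ∀ a, c * (L a ⬝ᵥ B *ᵥ L a) ≤ e * (L a ⬝ᵥ A *ᵥ L a))
    (i : Fin n) (hi : (i : ℕ) + (d - n) < d) :
    c * sortedEigenvalue hB ⟨i + (d - n), hi⟩ ≤ e * sortedEigenvalue hA (Fin.castLE hnd i) := by
  obtain ⟨U, hU, hAU⟩ := exists_orthogonal_diagonalization hA
  obtain ⟨V, hV, hBV⟩ := exists_orthogonal_diagonalization hB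
  let k : Fin d := ⟨i + (d - n), hi⟩
  -- A kernel vector of `F` gives `L a` with no components along the eigenvectors of `B` after `k`
  -- and of `A` before `i`. These are `(n - 1 - i) + i = n - 1` conditions on `n` coordinates, so a
  -- nonzero solution exists.
  let F : (Fin n → ℝ) →ₗ[ℝ] (Finset.Ioi k → ℝ) × (Finset.Iio (Fin.castLE hnd i) → ℝ) :=
    ((LinearMap.funLeft ℝ ℝ (fun j : Finset.Ioi k => (j : Fin d)) ∘ₗ V.mulVecLin ∘ₗ L).prod
      (LinearMap.funLeft ℝ ℝ (fun j : Finset.Iio (Fin.castLE hnd i) => (j : Fin d)) ∘ₗ U.mulVecLin ∘ₗ L))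
  have hF : LinearMap.ker F ≠ ⊥ := by
    apply LinearMap.ker_ne_bot_of_finrank_lt
    have := i.isLt
    rw [Module.finrank_prod, Module.finrank_fintype_fun_eq_card, Module.finrank_fintype_fun_eq_card,
      Module.finrank_fintype_fun_eq_card, Fintype.card_coe, Fintype.card_coe, Fin.card_Ioi,
      Fin.card_Iio, Fintype.card_fin]
    simp only [k, Fin.val_castLE]
    omega
  obtain ⟨a, haF, ha0⟩ := (Submodule.ne_bot_iff _).1 hF
  have hF0 := LinearMap.mem_ker.1 haF
  have h1 : ∀ j, k < j → (V *ᵥ L a) j = 0 := fun j hj => by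
    simpa [F] using congrFun (congrArg Prod.fst hF0) ⟨j, Finset.mem_Ioi.2 hj⟩
  have h2 : ∀ j, j < Fin.castLE hnd i → (U *ᵥ L a) j = 0 := fun j hj => by
    simpa [F] using congrFun (congrArg Prod.snd hF0) ⟨j, Finset.mem_Iio.2 hj⟩
  have hpos : 0 < L a ⬝ᵥ L a := by
    have : L a ≠ 0 := fun h0 => ha0 (hL (by simpa using h0))
    simpa using (dotProduct_star_self_pos_iff (v := L a)).2 this
  have hBl : sortedEigenvalue hB k * (L a ⬝ᵥ L a) ≤ L a ⬝ᵥ B *ᵥ L a := by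
    rw [dotProduct_mulVec_of_diagonalization hBV, ← dotProduct_self_mulVec_of_orthogonal hV,
      Finset.mul_sum]
    refine Finset.sum_le_sum fun j _ => ?_
    rcases lt_or_ge k j with hj | hj
    · simp [h1 j hj]
    · exact mul_le_mul_of_nonneg_right (sortedEigenvalue_antitone hB hj) (sq_nonneg _)
  have hAl : L a ⬝ᵥ A *ᵥ L a ≤ sortedEigenvalue hA (Fin.castLE hnd i) * (L a ⬝ᵥ L a) := by
    rw [dotProduct_mulVec_of_diagonalization hAU, ← dotProduct_self_mulVec_of_orthogonal hU,
      Finset.mul_sum]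
    refine Finset.sum_le_sum fun j _ => ?_
    rcases lt_or_ge j (Fin.castLE hnd i) with hj | hj
    · simp [h2 j hj]
    · exact mul_le_mul_of_nonneg_right (sortedEigenvalue_antitone hA hj) (sq_nonneg _)
  refine le_of_mul_le_mul_right ?_ hpos
  calc c * sortedEigenvalue hB k * (L a ⬝ᵥ L a) ≤ c * (L a ⬝ᵥ B *ᵥ L a) := by
        rw [mul_assoc]; exact mul_le_mul_of_nonneg_left hBl hc
    _ ≤ e * (L a ⬝ᵥ A *ᵥ L a) := h a
    _ ≤ e * sortedEigenvalue hA (Fin.castLE hnd i) * (L a ⬝ᵥ L a) := by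
        rw [mul_assoc]; exact mul_le_mul_of_nonneg_left hAl he

/-! ### Nets on the sphere. -/

open Matrix in
/-- A `1/2`-net of the unit sphere. -/
theorem exists_sphere_net (n : ℕ) :
    ∃ N : Finset (Fin n → ℝ), N.card ≤ 5 ^ n ∧ (∀ y ∈ N, y ⬝ᵥ y = 1) ∧
      ∀ x : Fin n → ℝ, x ⬝ᵥ x = 1 → ∃ y ∈ N, 7 / 8 ≤ x ⬝ᵥ y := by
  classical
  -- For unit vectors `‖x - y‖² = 2 - 2⟨x, y⟩`, so inner product `7/8` is distance `1/2`.
  let Q : Finset (Fin n → ℝ) → Prop := fun s => (∀ y ∈ s, y ⬝ᵥ y = 1) ∧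
    ∀ x ∈ s, ∀ y ∈ s, x ≠ y → x ⬝ᵥ y < 7 / 8
  have hnorm : ∀ v : Fin n → ℝ, ‖WithLp.toLp 2 v‖ ^ 2 = v ⬝ᵥ v := fun v => by
    rw [EuclideanSpace.norm_sq_eq]; simp [dotProduct, sq]
  have hcard : ∀ s, Q s → s.card ≤ 5 ^ n := by
    rintro s ⟨h1, h2⟩
    -- Doubling gives norm `2` and mutual distance at least `1`, the normalisation behind the `5 ^
    -- n` packing bound.
    let f : (Fin n → ℝ) → EuclideanSpace ℝ (Fin n) := fun v => (2 : ℝ) • WithLp.toLp 2 v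
    have hf : Function.Injective f := fun v w hvw => by
      simpa [f] using hvw
    have := Besicovitch.card_le_of_separated (s.image f) (by
      intro c hc
      obtain ⟨y, hy, rfl⟩ := Finset.mem_image.1 hc
      have := hnorm y
      rw [h1 y hy] at this
      have h1' : ‖WithLp.toLp 2 y‖ = 1 := by
        nlinarith [norm_nonneg (WithLp.toLp 2 y)]
      simp [f, norm_smul, h1']) (by
      intro c hc c' hc' hne
      obtain ⟨x, hx, rfl⟩ := Finset.mem_image.1 hc
      obtain ⟨y, hy, rfl⟩ := Finset.mem_image.1 hc'
      have hxy : x ≠ y := fun h => hne (by rw [h])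
      have h3 := h2 x hx y hy hxy
      have h4 : ‖WithLp.toLp 2 (x - y)‖ ^ 2 = 2 - 2 * (x ⬝ᵥ y) := by
        rw [hnorm, sub_dotProduct, dotProduct_sub, dotProduct_sub, h1 x hx, h1 y hy,
          dotProduct_comm y x]; ring
      have h5 : f x - f y = (2 : ℝ) • WithLp.toLp 2 (x - y) := by
        simp [f, smul_sub]
      rw [h5, norm_smul]
      have := norm_nonneg (WithLp.toLp 2 (x - y))
      simp only [Real.norm_ofNat]
      nlinarith)
    rwa [Finset.card_image_of_injective _ hf, finrank_euclideanSpace_fin] at this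
  -- A separated set of largest cardinality is a net: a point far from all of it could be added.
  let T : Set ℕ := {k | ∃ s, Q s ∧ s.card = k}
  have hTne : T.Nonempty := ⟨0, ∅, by simp [Q], rfl⟩
  have hTb : BddAbove T := ⟨5 ^ n, by rintro k ⟨s, hs, rfl⟩; exact hcard s hs⟩
  obtain ⟨N, hN, hNc⟩ := Nat.sSup_mem hTne hTb
  refine ⟨N, hcard N hN, hN.1, fun x hx => ?_⟩
  by_contra! hcon
  have hxN : x ∉ N := fun hmem => by have := hcon x hmem; rw [hx] at this; norm_num at this
  have : (insert x N).card ≤ sSup T := le_csSup hTb ⟨insert x N, ⟨?_, ?_⟩, rfl⟩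
  · rw [Finset.card_insert_of_notMem hxN, hNc] at this; omega
  · intro y hy
    rcases Finset.mem_insert.1 hy with rfl | hy
    exacts [hx, hN.1 y hy]
  · intro y hy z hz hyz
    rcases Finset.mem_insert.1 hy with rfl | hy' <;> rcases Finset.mem_insert.1 hz with rfl | hz'
    · exact absurd rfl hyz
    · exact hcon z hz'
    · rw [dotProduct_comm]; exact hcon y hy'
    · exact hN.2 y hy' z hz' hyz

open Matrix in
/-- A quadratic form is controlled on the sphere by its values on a `1/2`-net. -/
theorem abs_quadraticForm_le_of_net {n : ℕ} {B : Matrix (Fin n) (Fin n) ℝ} (hB : B.IsHermitian)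
    {N : Set (Fin n → ℝ)} (hN1 : ∀ y ∈ N, y ⬝ᵥ y = 1)
    (hN : ∀ x : Fin n → ℝ, x ⬝ᵥ x = 1 → ∃ y ∈ N, 7 / 8 ≤ x ⬝ᵥ y) {δ : ℝ}
    (h : ∀ y ∈ N, |y ⬝ᵥ B *ᵥ y| ≤ δ) (a : Fin n → ℝ) :
    |a ⬝ᵥ B *ᵥ a| ≤ 2 * δ * (a ⬝ᵥ a) := by
  obtain ⟨U, hU, hBU⟩ := exists_orthogonal_diagonalization hB
  set l := sortedEigenvalue hB
  rcases isEmpty_or_nonempty (Fin n) with hn | hn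
  · simp [dotProduct]
  -- Take a net point near the eigenvector of the largest `|l k|`. That direction carries weight at
  -- least `49/64`, the others at most `15/64`, so `(34/64) |l k| ≤ δ`.
  obtain ⟨k, hk⟩ := Finite.exists_max fun j => |l j|
  have hl : |l k| ≤ 2 * δ := by
    obtain ⟨y, hy, hxy⟩ := hN (U k) (by
      simpa [mul_apply, dotProduct] using congrFun (congrFun hU k) k)
    set w := U *ᵥ y
    have hw : 7 / 8 ≤ w k := hxy
    have hw1 : ∑ j, w j ^ 2 = 1 := by rw [dotProduct_self_mulVec_of_orthogonal hU, hN1 y hy]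
    have hy2 := h y hy
    rw [dotProduct_mulVec_of_diagonalization hBU,
      ← Finset.add_sum_erase _ _ (Finset.mem_univ k)] at hy2
    rw [← Finset.add_sum_erase _ _ (Finset.mem_univ k)] at hw1
    have hrest : |∑ j ∈ Finset.univ.erase k, l j * w j ^ 2| ≤
        |l k| * ∑ j ∈ Finset.univ.erase k, w j ^ 2 := by
      rw [Finset.mul_sum]
      refine (Finset.abs_sum_le_sum_abs _ _).trans (Finset.sum_le_sum fun j _ => ?_)
      rw [abs_mul, abs_of_nonneg (sq_nonneg (w j))]
      exact mul_le_mul_of_nonneg_right (hk j) (sq_nonneg _)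
    have hmain : |l k| * w k ^ 2 ≤ δ + |l k| * ∑ j ∈ Finset.univ.erase k, w j ^ 2 := by
      have h3 := abs_sub_abs_le_abs_sub (l k * w k ^ 2)
        (-∑ j ∈ Finset.univ.erase k, l j * w j ^ 2)
      rw [abs_neg, sub_neg_eq_add, abs_mul, abs_of_nonneg (sq_nonneg (w k))] at h3
      change |l k * w k ^ 2 + _| ≤ δ at hy2
      linarith
    have hw2 : 49 / 64 ≤ w k ^ 2 := by nlinarith
    have h0 := abs_nonneg (l k)
    have : ∑ j ∈ Finset.univ.erase k, w j ^ 2 = 1 - w k ^ 2 := by linarith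
    rw [this] at hmain
    nlinarith
  rw [dotProduct_mulVec_of_diagonalization hBU, ← dotProduct_self_mulVec_of_orthogonal hU,
    Finset.mul_sum]
  refine (Finset.abs_sum_le_sum_abs _ _).trans (Finset.sum_le_sum fun j _ => ?_)
  rw [abs_mul, abs_of_nonneg (sq_nonneg ((U *ᵥ a) j))]
  exact mul_le_mul_of_nonneg_right ((hk j).trans hl) (sq_nonneg _)

/-! ### Independence of rows. -/

/-- Grouping an independent family indexed by a product into independent rows. -/
theorem iIndepFun.curry {Ω ι κ E : Type*} [MeasurableSpace Ω] [MeasurableSpace E]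
    {P : Measure Ω} [IsProbabilityMeasure P] {X : ι → κ → Ω → E} (mX : ∀ i j, Measurable (X i j))
    (h : iIndepFun (fun (p : ι × κ) ω => X p.1 p.2 ω) P) :
    iIndepFun (fun i ω j => X i j ω) P := by
  have hprob : ∀ i j, IsProbabilityMeasure (P.map (X i j)) :=
    fun i j ↦ Measure.isProbabilityMeasure_map (mX i j).aemeasurable
  have hs : iIndepFun (fun (p : (_ : ι) × κ) ω => X p.1 p.2 ω) P :=
    h.precomp (g := Equiv.sigmaEquivProd ι κ) (Equiv.sigmaEquivProd ι κ).injective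
  have h2 : ∀ i, iIndepFun (X i) P := fun i =>
    h.precomp (g := fun j => (i, j)) (fun _ _ hj => (Prod.mk.inj hj).2)
  rw [iIndepFun_iff_map_fun_eq_infinitePi_map (by fun_prop)] at hs
  rw [iIndepFun_iff_map_fun_eq_infinitePi_map (by fun_prop)]
  -- Independence says that the joint law is a product measure; currying a product measure over
  -- pairs gives a product of products.
  have hcur : (MeasurableEquiv.piCurry fun (_ : ι) (_ : κ) => E) ∘ (fun ω p ↦ X p.1 p.2 ω) =
      fun ω i j ↦ X i j ω := by
    ext; simp [Sigma.curry]
  have := congrArg (Measure.map (MeasurableEquiv.piCurry fun (_ : ι) (_ : κ) => E)) hs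
  rw [Measure.map_map (by fun_prop) (by fun_prop), hcur,
    Measure.infinitePi_map_piCurry (fun i j ↦ P.map (X i j))] at this
  rw [this]
  congr 1
  ext1 i
  rw [(iIndepFun_iff_map_fun_eq_infinitePi_map (by fun_prop)).1 (h2 i)]

/-! ### Moments, exponential moments and Bernstein's inequality. -/

section Moments

variable {Ω : Type*} [MeasurableSpace Ω] {P : Measure Ω}

theorem natCast_pow_self_le_factorial_mul_exp (p : ℕ) :
    (p : ℝ) ^ p ≤ p.factorial * Real.exp 1 ^ p := by
  have h := Real.pow_div_factorial_le_exp p (Nat.cast_nonneg p) p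
  rw [div_le_iff₀ (by positivity)] at h
  rw [← Real.exp_nat_mul, mul_one, mul_comm]
  exact h

/-- Even moments growing like `p! v ^ p` give a square-exponential moment. -/
theorem integrable_exp_sq_of_moments {Y : Ω → ℝ} (hY : Measurable Y) {v : ℝ} (hv : 0 < v)
    (h : ∀ p : ℕ, ∫⁻ ω, ENNReal.ofReal (Y ω ^ (2 * p)) ∂P ≤
      ENNReal.ofReal (p.factorial * v ^ p)) :
    Integrable (fun ω => Real.exp ((2 * v)⁻¹ * Y ω ^ 2)) P ∧
      ∫ ω, Real.exp ((2 * v)⁻¹ * Y ω ^ 2) ∂P ≤ 2 := by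
  -- Expand the exponential and integrate termwise: the `p!` cancels and the `p`-th term is at most
  -- `2^{-p}`.
  have hlin : ∫⁻ ω, ENNReal.ofReal (Real.exp ((2 * v)⁻¹ * Y ω ^ 2)) ∂P ≤ 2 := by
    calc ∫⁻ ω, ENNReal.ofReal (Real.exp ((2 * v)⁻¹ * Y ω ^ 2)) ∂P
        = ∫⁻ ω, ∑' p : ℕ, ENNReal.ofReal (((2 * v)⁻¹ * Y ω ^ 2) ^ p / p.factorial) ∂P := by
          refine lintegral_congr fun ω => ?_
          rw [Real.exp_eq_exp_ℝ, NormedSpace.exp_eq_tsum_div, ENNReal.ofReal_tsum_of_nonneg]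
          · intro p; positivity
          · exact NormedSpace.expSeries_div_summable _
      _ = ∑' p : ℕ, ∫⁻ ω, ENNReal.ofReal (((2 * v)⁻¹ * Y ω ^ 2) ^ p / p.factorial) ∂P :=
          lintegral_tsum fun p => by fun_prop
      _ ≤ ∑' p : ℕ, ENNReal.ofReal ((1 / 2) ^ p) := by
          refine ENNReal.tsum_le_tsum fun p => ?_
          have h1 : ∀ ω, ENNReal.ofReal (((2 * v)⁻¹ * Y ω ^ 2) ^ p / p.factorial) =
              ENNReal.ofReal ((2 * v)⁻¹ ^ p / p.factorial) * ENNReal.ofReal (Y ω ^ (2 * p)) := by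
            intro ω
            rw [← ENNReal.ofReal_mul (by positivity), mul_pow, ← pow_mul]
            congr 1; ring
          simp_rw [h1]
          rw [lintegral_const_mul _ (by fun_prop)]
          refine (mul_le_mul_right (h p) _).trans ?_
          rw [← ENNReal.ofReal_mul (by positivity)]
          refine ENNReal.ofReal_le_ofReal (le_of_eq ?_)
          rw [div_mul_eq_mul_div, mul_comm (p.factorial : ℝ), ← mul_assoc, mul_div_cancel_right₀ _
            (by positivity), ← mul_pow]
          congr 1; field_simp
      _ = 2 := by
          rw [← ENNReal.ofReal_tsum_of_nonneg (fun p => by positivity) summable_geometric_two,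
            tsum_geometric_two]; simp
  have hm : AEStronglyMeasurable (fun ω => Real.exp ((2 * v)⁻¹ * Y ω ^ 2)) P :=
    (by fun_prop : Measurable _).aestronglyMeasurable
  constructor
  · refine ⟨hm, ?_⟩
    rw [hasFiniteIntegral_iff_ofReal (Filter.Eventually.of_forall fun _ => (Real.exp_pos _).le)]
    exact hlin.trans_lt (by simp)
  · rw [integral_eq_lintegral_of_nonneg_ae (Filter.Eventually.of_forall fun _ => (Real.exp_pos _).le) hm]
    exact ENNReal.toReal_le_of_le_ofReal (by norm_num) (by simpa using hlin)

/-- The exponent `2p` in the supremum gives `E Y^{2p} ≤ (2pK²)^p`, and `p^p ≤ p! e^p` brings this to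
the form used by `integrable_exp_sq_of_moments`. -/
theorem lintegral_pow_le_of_subgaussianNorm_le [IsProbabilityMeasure P] {Y : Ω → ℝ} {K : ℝ}
    (hK : 0 ≤ K)
    (h : subgaussianNorm Y P ≤ ENNReal.ofReal K) (p : ℕ) :
    ∫⁻ ω, ENNReal.ofReal (Y ω ^ (2 * p)) ∂P ≤
      ENNReal.ofReal (p.factorial * (2 * Real.exp 1 * K ^ 2) ^ p) := by
  rcases Nat.eq_zero_or_pos p with rfl | hp
  · simp
  have hq : (1 : ℝ) ≤ ((2 * p : ℕ) : ℝ) := by exact_mod_cast (by omega : 1 ≤ 2 * p)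
  set q : ℝ := ((2 * p : ℕ) : ℝ) with hqdef
  have h1 : eLpNorm Y (ENNReal.ofReal q) P / ENNReal.ofReal (Real.sqrt q) ≤ ENNReal.ofReal K :=
    (le_iSup₂ (f := fun (p : ℝ) (_ : 1 ≤ p) =>
      eLpNorm Y (ENNReal.ofReal p) P / ENNReal.ofReal (Real.sqrt p)) q hq).trans h
  have hsq : 0 < Real.sqrt q := Real.sqrt_pos.2 (by linarith)
  rw [ENNReal.div_le_iff (by simpa using hsq) (by simp), ← ENNReal.ofReal_mul hK,
    eLpNorm_eq_lintegral_rpow_enorm_toReal (by simp; linarith) (by simp),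
    ENNReal.toReal_ofReal (by linarith), one_div,
    ENNReal.rpow_inv_le_iff (by linarith)] at h1
  have h2 : ∀ ω, ENNReal.ofReal (Y ω ^ (2 * p)) = ‖Y ω‖ₑ ^ q := by
    intro ω
    rw [hqdef, ENNReal.rpow_natCast, Real.enorm_eq_ofReal_abs, ← ENNReal.ofReal_pow (abs_nonneg _),
      Even.pow_abs (even_two_mul p)]
  simp_rw [h2]
  refine h1.trans ?_
  rw [hqdef, ENNReal.rpow_natCast, ← ENNReal.ofReal_pow (by positivity)]
  refine ENNReal.ofReal_le_ofReal ?_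
  rw [pow_mul, mul_pow, Real.sq_sqrt (by positivity)]
  have := natCast_pow_self_le_factorial_mul_exp p
  calc (K ^ 2 * ((2 * p : ℕ) : ℝ)) ^ p = (2 * K ^ 2) ^ p * (p : ℝ) ^ p := by
        rw [← mul_pow]; push_cast; ring
    _ ≤ (2 * K ^ 2) ^ p * (p.factorial * Real.exp 1 ^ p) := by gcongr
    _ = _ := by rw [mul_pow, mul_pow, mul_pow]; ring

/-- The linear term is kept exactly, so that it vanishes on integrating a centred variable. -/
theorem exp_le_self_add_exp_sq (s : ℝ) : Real.exp s ≤ s + Real.exp (s ^ 2) := by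
  have h := Real.add_one_le_exp (s ^ 2)
  rcases le_or_gt |s| 1 with hs | hs
  · have := (abs_le.1 (Real.abs_exp_sub_one_sub_id_le hs)).2
    linarith
  · rcases lt_abs.1 hs with hs | hs
    · have : Real.exp s ≤ Real.exp (s ^ 2) := Real.exp_le_exp.2 (by nlinarith)
      linarith
    · have : Real.exp s ≤ 1 := Real.exp_le_one_iff.2 (by linarith)
      nlinarith

/-- A centred variable with a square-exponential moment has sub-Gaussian moment generating
function. -/
theorem hasSubgaussianMGF_of_exp_sq [IsProbabilityMeasure P] {Y : Ω → ℝ} (hY : Measurable Y)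
    (hi : Integrable Y P) (h0 : ∫ ω, Y ω ∂P = 0) {η : NNReal} (hη : 0 < η)
    (hint : Integrable (fun ω => Real.exp (η * Y ω ^ 2)) P)
    (hle : ∫ ω, Real.exp (η * Y ω ^ 2) ∂P ≤ 2) :
    HasSubgaussianMGF Y (3 / η) P := by
  have hη' : (0 : ℝ) < η := hη
  have hbd : ∀ (s : ℝ) ω, Real.exp (s * Y ω) ≤
      Real.exp (s ^ 2 / (2 * η)) * Real.exp (η * Y ω ^ 2) := by
    intro s ω
    rw [← Real.exp_add]
    refine Real.exp_le_exp.2 ?_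
    have h1 : s ^ 2 / (2 * η) + η * Y ω ^ 2 - s * Y ω =
        ((s - η * Y ω) ^ 2 + (η * Y ω) ^ 2) / (2 * η) := by
      field_simp; ring
    have : 0 ≤ ((s - η * Y ω) ^ 2 + (η * Y ω) ^ 2) / (2 * η) := by positivity
    linarith
  have hI : ∀ s : ℝ, Integrable (fun ω => Real.exp (s * Y ω)) P := by
    intro s
    refine (hint.const_mul (Real.exp (s ^ 2 / (2 * η)))).mono'
      (by fun_prop : Measurable _).aestronglyMeasurable (Filter.Eventually.of_forall fun ω => ?_)
    rw [Real.norm_of_nonneg (Real.exp_pos _).le]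
    exact hbd s ω
  refine ⟨hI, fun s => ?_⟩
  rw [mgf]
  have hθ0 : 0 ≤ s ^ 2 / η := by positivity
  have hfin : ((3 / η : NNReal) : ℝ) * s ^ 2 / 2 = s ^ 2 / η + s ^ 2 / (2 * η) := by
    push_cast; field_simp; ring
  rw [hfin]
  -- For `s² ≤ η`, centring and convexity of `exp` between `0` and `ηY²` give the bound `1 + s²/η`.
  -- For larger `s`, `hbd` suffices, since the factor `2` is absorbed by `exp(s²/η)`.
  rcases le_total (s ^ 2) η with hs | hs
  · have hθ1 : s ^ 2 / η ≤ 1 := (div_le_one hη').2 hs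
    set θ := s ^ 2 / (η : ℝ)
    have hpt : ∀ ω, Real.exp (s * Y ω) ≤ s * Y ω + ((1 - θ) + θ * Real.exp (η * Y ω ^ 2)) := by
      intro ω
      refine (exp_le_self_add_exp_sq _).trans ?_
      have := convexOn_exp.2 (Set.mem_univ 0) (Set.mem_univ (η * Y ω ^ 2)) (sub_nonneg.2 hθ1) hθ0
        (by ring)
      simp only [smul_eq_mul, mul_zero, zero_add, Real.exp_zero, mul_one] at this
      have he : θ * (η * Y ω ^ 2) = (s * Y ω) ^ 2 := by simp only [θ]; field_simp
      rw [he] at this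
      linarith
    calc ∫ ω, Real.exp (s * Y ω) ∂P
        ≤ ∫ ω, (s * Y ω + ((1 - θ) + θ * Real.exp (η * Y ω ^ 2))) ∂P :=
          integral_mono (hI s) ((hi.const_mul s).add ((integrable_const _).add (hint.const_mul θ)))
            hpt
      _ = 1 - θ + θ * ∫ ω, Real.exp (η * Y ω ^ 2) ∂P := by
          have e1 := integral_add (hi.const_mul s)
            ((integrable_const (1 - θ)).add (hint.const_mul θ))
          have e2 := integral_add (integrable_const (1 - θ)) (hint.const_mul θ)
          simp only [Pi.add_apply] at e1
          rw [e1, e2, integral_const_mul, integral_const_mul, h0]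
          simp
      _ ≤ 1 + θ := by nlinarith
      _ ≤ Real.exp (θ + s ^ 2 / (2 * η)) := by
          have := Real.add_one_le_exp (θ + s ^ 2 / (2 * η))
          have : 0 ≤ s ^ 2 / (2 * (η : ℝ)) := by positivity
          linarith
  · calc ∫ ω, Real.exp (s * Y ω) ∂P
        ≤ ∫ ω, Real.exp (s ^ 2 / (2 * η)) * Real.exp (η * Y ω ^ 2) ∂P :=
          integral_mono (hI s) (hint.const_mul _) (hbd s)
      _ ≤ Real.exp (s ^ 2 / (2 * η)) * 2 := by
          rw [integral_const_mul]
          exact mul_le_mul_of_nonneg_left hle (Real.exp_pos _).le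
      _ ≤ Real.exp (s ^ 2 / η + s ^ 2 / (2 * η)) := by
          rw [Real.exp_add, mul_comm]
          refine mul_le_mul_of_nonneg_right ?_ (Real.exp_pos _).le
          have : 1 ≤ s ^ 2 / (η : ℝ) := (one_le_div hη').2 hs
          have := Real.add_one_le_exp (s ^ 2 / (η : ℝ))
          linarith

/-- Even moments of a variable with sub-Gaussian moment generating function. -/
theorem lintegral_pow_le_of_hasSubgaussianMGF [IsProbabilityMeasure P] {Y : Ω → ℝ}
    {c : NNReal} (hc : 0 < c) (h : HasSubgaussianMGF Y c P) (p : ℕ) :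
    ∫⁻ ω, ENNReal.ofReal (Y ω ^ (2 * p)) ∂P ≤
      ENNReal.ofReal (p.factorial * (Real.exp 1 * c) ^ p) := by
  rcases Nat.eq_zero_or_pos p with rfl | hp
  · simp
  have hc' : (0 : ℝ) < c := hc
  have hp' : (0 : ℝ) < p := by exact_mod_cast hp
  -- This `s` minimises `s^{-2p} exp(c s²/2)`; there the exponential equals `e^p`.
  set s : ℝ := Real.sqrt (2 * p / c)
  have hs2 : s ^ 2 = 2 * p / c := Real.sq_sqrt (by positivity)
  set κ : ℝ := (2 * p).factorial / (2 * p / c) ^ p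
  have hκ : 0 ≤ κ := by positivity
  have hpt : ∀ ω, Y ω ^ (2 * p) ≤ κ * Real.cosh (s * Y ω) := by
    intro ω
    have h1 : (s * Y ω) ^ (2 * p) / (2 * p).factorial ≤ Real.cosh (s * Y ω) :=
      le_hasSum (Real.hasSum_cosh (s * Y ω)) p fun j _ =>
        div_nonneg ((even_two_mul j).pow_nonneg _) (by positivity)
    have h2 : Y ω ^ (2 * p) = κ * ((s * Y ω) ^ (2 * p) / (2 * p).factorial) := by
      rw [mul_pow, pow_mul s, hs2]
      simp only [κ]
      have : (2 * p / (c : ℝ)) ^ p ≠ 0 := by positivity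
      have : ((2 * p).factorial : ℝ) ≠ 0 := by positivity
      field_simp
    rw [h2]
    exact mul_le_mul_of_nonneg_left h1 hκ
  have hcosh : (fun ω => Real.cosh (s * Y ω)) =
      fun ω => (Real.exp (s * Y ω) + Real.exp (-s * Y ω)) / 2 := by
    ext ω; rw [Real.cosh_eq, neg_mul]
  have hI : Integrable (fun ω => Real.cosh (s * Y ω)) P := by
    rw [hcosh]
    exact ((h.integrable_exp_mul s).add (h.integrable_exp_mul (-s))).div_const 2
  have hE : ∫ ω, Real.cosh (s * Y ω) ∂P ≤ Real.exp p := by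
    have h1 := h.mgf_le s
    have h2 := h.mgf_le (-s)
    have h3 : (c : ℝ) * s ^ 2 / 2 = p := by rw [hs2]; field_simp
    rw [neg_sq, h3] at h2
    rw [h3] at h1
    rw [hcosh, integral_div, integral_add (h.integrable_exp_mul s) (h.integrable_exp_mul (-s))]
    simp only [mgf] at h1 h2
    linarith
  calc ∫⁻ ω, ENNReal.ofReal (Y ω ^ (2 * p)) ∂P
      ≤ ∫⁻ ω, ENNReal.ofReal (κ * Real.cosh (s * Y ω)) ∂P :=
        lintegral_mono fun ω => ENNReal.ofReal_le_ofReal (hpt ω)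
    _ = ENNReal.ofReal (∫ ω, κ * Real.cosh (s * Y ω) ∂P) :=
        (ofReal_integral_eq_lintegral_ofReal (hI.const_mul κ) (Filter.Eventually.of_forall
          fun ω => mul_nonneg hκ (Real.cosh_pos _).le)).symm
    _ ≤ _ := by
        refine ENNReal.ofReal_le_ofReal ?_
        rw [integral_const_mul]
        refine (mul_le_mul_of_nonneg_left hE hκ).trans ?_
        have h4 : ((2 * p).factorial : ℝ) ≤ (2 * p) ^ p * p.factorial := by
          exact_mod_cast Nat.factorial_two_mul_le p
        calc κ * Real.exp p ≤ ((2 * p) ^ p * p.factorial) / (2 * p / c) ^ p * Real.exp p := by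
              simp only [κ]; gcongr
          _ = p.factorial * (Real.exp 1 * c) ^ p := by
              rw [mul_pow (Real.exp 1), ← Real.exp_nat_mul, mul_one, div_pow]
              field_simp

/-- The centred square of a normalised variable with a square-exponential moment is
sub-exponential. -/
theorem mgf_sq_sub_one_le [IsProbabilityMeasure P] {Y : Ω → ℝ} (hY : Measurable Y)
    (hi : Integrable (fun ω => Y ω ^ 2) P) (h1 : ∫ ω, Y ω ^ 2 ∂P = 1) {η : ℝ} (hη : 0 < η)
    (hint : Integrable (fun ω => Real.exp (η * Y ω ^ 2)) P)
    (hle : ∫ ω, Real.exp (η * Y ω ^ 2) ∂P ≤ 2) {s : ℝ} (hs : |s| ≤ η / 2) :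
    Integrable (fun ω => Real.exp (s * (Y ω ^ 2 - 1))) P ∧
      mgf (fun ω => Y ω ^ 2 - 1) P s ≤ Real.exp (16 * s ^ 2 / η ^ 2) := by
  have hpt : ∀ ω, Real.exp (s * Y ω ^ 2) ≤
      1 + s * Y ω ^ 2 + 8 * s ^ 2 / η ^ 2 * Real.exp (η * Y ω ^ 2) := by
    intro ω
    set y := Y ω ^ 2
    have hy : 0 ≤ y := sq_nonneg _
    have h2 := Complex.norm_exp_sub_sum_le_norm_mul_exp (s * y : ℂ) 2
    have h3 : ‖Complex.exp (s * y : ℂ) - ∑ m ∈ Finset.range 2, (s * y : ℂ) ^ m / m.factorial‖ =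
        |Real.exp (s * y) - (1 + s * y)| := by
      rw [← Real.norm_eq_abs, ← Complex.norm_real]
      congr 1
      simp [Finset.sum_range_succ]
    rw [h3, ← Complex.ofReal_mul, Complex.norm_real, Real.norm_eq_abs, sq_abs] at h2
    have h4 := (abs_le.1 h2).2
    -- Split `exp(ηy)` into two equal factors: one dominates `exp |sy|`, the other the quadratic
    -- `(ηy/2)²/2`.
    have h5 : (s * y) ^ 2 * Real.exp |s * y| ≤ 8 * s ^ 2 / η ^ 2 * Real.exp (η * y) := by
      have h6 : |s * y| ≤ η / 2 * y := by
        rw [abs_mul, abs_of_nonneg hy]; exact mul_le_mul_of_nonneg_right hs hy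
      have h7 : (η / 2 * y) ^ 2 / 2 ≤ Real.exp (η / 2 * y) := by
        have := Real.quadratic_le_exp_of_nonneg (x := η / 2 * y) (by positivity)
        have : 0 ≤ η / 2 * y := by positivity
        linarith
      have h8 : (s * y) ^ 2 = 8 * s ^ 2 / η ^ 2 * ((η / 2 * y) ^ 2 / 2) := by
        field_simp; ring
      have h9 : Real.exp (η * y) = Real.exp (η / 2 * y) * Real.exp (η / 2 * y) := by
        rw [← Real.exp_add]; congr 1; ring
      rw [h8, h9, mul_assoc]
      have := Real.exp_le_exp.2 h6
      gcongr
    linarith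
  have hIs : Integrable (fun ω => Real.exp (s * Y ω ^ 2)) P := by
    refine hint.mono' (by fun_prop : Measurable _).aestronglyMeasurable
      (Filter.Eventually.of_forall fun ω => ?_)
    rw [Real.norm_of_nonneg (Real.exp_pos _).le]
    refine Real.exp_le_exp.2 (mul_le_mul_of_nonneg_right ?_ (sq_nonneg _))
    linarith [(abs_le.1 hs).2]
  have hfac : (fun ω => Real.exp (s * (Y ω ^ 2 - 1))) =
      fun ω => Real.exp (-s) * Real.exp (s * Y ω ^ 2) := by
    ext ω; rw [← Real.exp_add]; congr 1; ring
  refine ⟨by rw [hfac]; exact hIs.const_mul _, ?_⟩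
  have hE : ∫ ω, Real.exp (s * Y ω ^ 2) ∂P ≤ 1 + s + 16 * s ^ 2 / η ^ 2 := by
    calc ∫ ω, Real.exp (s * Y ω ^ 2) ∂P
        ≤ ∫ ω, (1 + s * Y ω ^ 2 + 8 * s ^ 2 / η ^ 2 * Real.exp (η * Y ω ^ 2)) ∂P :=
          integral_mono hIs (((integrable_const _).add (hi.const_mul s)).add (hint.const_mul _)) hpt
      _ = 1 + s + 8 * s ^ 2 / η ^ 2 * ∫ ω, Real.exp (η * Y ω ^ 2) ∂P := by
          have e1 := integral_add ((integrable_const (1 : ℝ)).add (hi.const_mul s))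
            (hint.const_mul (8 * s ^ 2 / η ^ 2))
          have e2 := integral_add (integrable_const (1 : ℝ)) (hi.const_mul s)
          simp only [Pi.add_apply] at e1
          rw [e1, e2, integral_const_mul, integral_const_mul, h1]
          simp
      _ ≤ 1 + s + 8 * s ^ 2 / η ^ 2 * 2 := by gcongr
      _ = _ := by ring
  rw [mgf, hfac, integral_const_mul]
  calc Real.exp (-s) * ∫ ω, Real.exp (s * Y ω ^ 2) ∂P
      ≤ Real.exp (-s) * Real.exp (s + 16 * s ^ 2 / η ^ 2) := by
        refine mul_le_mul_of_nonneg_left (hE.trans ?_) (Real.exp_pos _).le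
        linarith [Real.add_one_le_exp (s + 16 * s ^ 2 / η ^ 2)]
    _ = _ := by rw [← Real.exp_add]; congr 1; ring

/-- Bernstein's inequality for sums of independent centred squares. -/
theorem measureReal_abs_sum_sq_sub_one_le [IsProbabilityMeasure P] {d : ℕ} {Y : Fin d → Ω → ℝ}
    (hY : ∀ j, Measurable (Y j)) (hind : iIndepFun Y P)
    (hi : ∀ j, Integrable (fun ω => Y j ω ^ 2) P) (h1 : ∀ j, ∫ ω, Y j ω ^ 2 ∂P = 1)
    {η : ℝ} (hη : 0 < η) (hint : ∀ j, Integrable (fun ω => Real.exp (η * Y j ω ^ 2)) P)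
    (hle : ∀ j, ∫ ω, Real.exp (η * Y j ω ^ 2) ∂P ≤ 2) {ε : ℝ} (hε : 0 ≤ ε) :
    P.real {ω | d * (12 / η * max ε (ε ^ 2)) ≤ |∑ j, (Y j ω ^ 2 - 1)|} ≤
      2 * Real.exp (-(2 * (d * ε ^ 2))) := by
  set m := max ε (ε ^ 2)
  set W : Fin d → Ω → ℝ := fun j ω => Y j ω ^ 2 - 1 with hW
  have hWm : ∀ j, Measurable (W j) := fun j => by fun_prop
  have hWi : iIndepFun W P := hind.comp (fun _ y => y ^ 2 - 1) fun _ => by fun_prop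
  have hmgf : ∀ s : ℝ, |s| ≤ η / 2 → Integrable (fun ω => Real.exp (s * (∑ j, W j) ω)) P ∧
      mgf (∑ j, W j) P s ≤ Real.exp (d * (16 * s ^ 2 / η ^ 2)) := by
    intro s hs
    have h2 := fun j => mgf_sq_sub_one_le (hY j) (hi j) (h1 j) hη (hint j) (hle j) hs
    refine ⟨hWi.integrable_exp_mul_sum hWm fun j _ => (h2 j).1, ?_⟩
    rw [hWi.mgf_sum hWm, Real.exp_nat_mul]
    refine (Finset.prod_le_prod (fun j _ => mgf_nonneg) fun j _ => (h2 j).2).trans ?_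
    simp
  -- Chernoff parameter: `ηε/2` for `ε ≤ 1`, otherwise the end `η/2` of the admissible range. The
  -- `12` makes both cases close: `2ε² + 4ε² = 6ε²` and `2ε² + 4 ≤ 6ε²`.
  obtain ⟨s, hs0, hs1, hs2⟩ : ∃ s : ℝ, 0 ≤ s ∧ s ≤ η / 2 ∧
      2 * ε ^ 2 + 16 * s ^ 2 / η ^ 2 ≤ s * (12 / η * m) := by
    rcases le_total ε 1 with h | h
    · refine ⟨η * ε / 2, by positivity, by nlinarith, ?_⟩
      have hm : ε ≤ m := le_max_left _ _
      have e1 : 16 * (η * ε / 2) ^ 2 / η ^ 2 = 4 * ε ^ 2 := by field_simp; ring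
      have e2 : η * ε / 2 * (12 / η * m) = 6 * ε * m := by field_simp; ring
      rw [e1, e2]; nlinarith
    · refine ⟨η / 2, by positivity, le_rfl, ?_⟩
      have hm : ε ^ 2 ≤ m := le_max_right _ _
      have e1 : 16 * (η / 2) ^ 2 / η ^ 2 = 4 := by field_simp; norm_num
      have e2 : η / 2 * (12 / η * m) = 6 * m := by field_simp; ring
      rw [e1, e2]; nlinarith
  have hd : (0 : ℝ) ≤ d := Nat.cast_nonneg d
  have hexp : -s * (d * (12 / η * m)) + d * (16 * s ^ 2 / η ^ 2) ≤ -(2 * (d * ε ^ 2)) := by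
    nlinarith [mul_le_mul_of_nonneg_left hs2 hd]
  obtain ⟨hp1, hp2⟩ := hmgf s (by rwa [abs_of_nonneg hs0])
  obtain ⟨hn1, hn2⟩ := hmgf (-s) (by rwa [abs_neg, abs_of_nonneg hs0])
  have hup : P.real {ω | d * (12 / η * m) ≤ (∑ j, W j) ω} ≤ Real.exp (-(2 * (d * ε ^ 2))) := by
    refine (measure_ge_le_exp_mul_mgf _ hs0 hp1).trans ?_
    refine (mul_le_mul_of_nonneg_left hp2 (Real.exp_pos _).le).trans ?_
    rw [← Real.exp_add]; exact Real.exp_le_exp.2 hexp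
  have hlo : P.real {ω | (∑ j, W j) ω ≤ -(d * (12 / η * m))} ≤
      Real.exp (-(2 * (d * ε ^ 2))) := by
    refine (measure_le_le_exp_mul_mgf _ (neg_nonpos.2 hs0) hn1).trans ?_
    refine (mul_le_mul_of_nonneg_left hn2 (Real.exp_pos _).le).trans ?_
    rw [← Real.exp_add]
    refine Real.exp_le_exp.2 (le_trans (le_of_eq ?_) hexp)
    ring
  calc P.real {ω | d * (12 / η * m) ≤ |∑ j, (Y j ω ^ 2 - 1)|}
      ≤ P.real ({ω | d * (12 / η * m) ≤ (∑ j, W j) ω} ∪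
          {ω | (∑ j, W j) ω ≤ -(d * (12 / η * m))}) := by
        refine measureReal_mono fun ω hω => ?_
        simp only [Set.mem_ofPred_eq, Set.mem_union, Finset.sum_apply, hW] at hω ⊢
        rcases le_abs.1 hω with h | h
        · exact Or.inl h
        · exact Or.inr (by linarith)
    _ ≤ _ := (measureReal_union_le _ _).trans (by linarith)

end Moments

/-! ### Concentration of `‖Zᵀa‖²`, first for one vector, then uniformly. -/

section Concentration

variable {Ω : Type*} [MeasurableSpace Ω] {P : Measure Ω} [IsProbabilityMeasure P]

/-- Concentration of `‖Zᵀ a‖²` for a unit vector `a` and a matrix `Z` with independent,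
centred, normalised sub-Gaussian entries. -/
theorem measureReal_abs_sum_sq_linearCombination_le {n d : ℕ} {z : Fin n → Fin d → Ω → ℝ}
    (hz : ∀ i j, Measurable (z i j))
    (hind : iIndepFun (fun (p : Fin n × Fin d) ω => z p.1 p.2 ω) P)
    (hL2 : ∀ i j, MemLp (z i j) 2 P) (h0 : ∀ i j, ∫ ω, z i j ω ∂P = 0)
    (h1 : ∀ i j, variance (z i j) P = 1) {K : ℝ} (hK : 0 < K)
    (hψ : ∀ i j, subgaussianNorm (z i j) P ≤ ENNReal.ofReal K)
    {a : Fin n → ℝ} (ha : a ⬝ᵥ a = 1) {ε : ℝ} (hε : 0 ≤ ε) :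
    P.real {ω | d * (288 * Real.exp 1 ^ 2 * K ^ 2 * max ε (ε ^ 2)) ≤
        |∑ j, ((∑ i, a i * z i j ω) ^ 2 - 1)|} ≤
      2 * Real.exp (-(2 * (d * ε ^ 2))) := by
  have hsum : ∑ i, a i ^ 2 = 1 := by rw [← ha]; simp [dotProduct, sq]
  set Y : Fin d → Ω → ℝ := fun j ω => ∑ i, a i * z i j ω with hYdef
  have hYm : ∀ j, Measurable (Y j) := fun j => by fun_prop
  have hYi : iIndepFun Y P := by
    have hsw : iIndepFun (fun (p : Fin d × Fin n) ω => z p.2 p.1 ω) P :=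
      hind.precomp (g := Prod.swap) Prod.swap_injective
    exact (iIndepFun.curry (X := fun j i => z i j) (fun j i => hz i j) hsw).comp
      (fun _ v => ∑ i, a i * v i) fun _ => by fun_prop
  have hcol : ∀ j, iIndepFun (fun i => z i j) P := fun j =>
    hind.precomp (g := fun i => (i, j)) fun _ _ h => (Prod.mk.inj h).1
  have hcolm : ∀ j, iIndepFun (fun i ω => a i * z i j ω) P := fun j =>
    (hcol j).comp (fun i y => a i * y) fun _ => by fun_prop
  have hYL2 : ∀ j, MemLp (Y j) 2 P := fun j =>
    memLp_finsetSum _ fun i _ => (hL2 i j).const_mul (a i)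
  have hY0 : ∀ j, ∫ ω, Y j ω ∂P = 0 := fun j => by
    rw [integral_finsetSum _ fun i _ => ((hL2 i j).integrable (by norm_num)).const_mul (a i)]
    simp [integral_const_mul, h0]
  have hYsum : ∀ j, Y j = ∑ i, fun ω => a i * z i j ω := fun j => by
    ext ω; simp [hYdef]
  have hY1 : ∀ j, ∫ ω, Y j ω ^ 2 ∂P = 1 := fun j => by
    rw [← variance_of_integral_eq_zero (hYm j).aemeasurable (hY0 j), hYsum,
      IndepFun.variance_sum (fun i _ => (hL2 i j).const_mul (a i))
        fun i _ i' _ hii => (hcolm j).indepFun hii]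
    simp [variance_const_mul, h1, hsum]
  -- Constants: entries have exponential-square parameter `η₀ = 1/(4eK²)`, hence variance proxy `c =
  -- 3/η₀ = 12eK²`. A unit combination keeps `c`, as the weights `a i ^ 2` sum to `1`. Its own
  -- parameter is `1/(2ec)`, and Bernstein's `12/η` becomes `24ec = 288e²K²`.
  set η₀ : NNReal := ⟨(2 * (2 * Real.exp 1 * K ^ 2))⁻¹, by positivity⟩ with hη₀
  have hη₀c : (η₀ : ℝ) = (2 * (2 * Real.exp 1 * K ^ 2))⁻¹ := rfl
  have hη₀pos : 0 < η₀ := by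
    rw [← NNReal.coe_pos, hη₀c]; positivity
  have hzsub : ∀ i j, HasSubgaussianMGF (z i j) (3 / η₀) P := fun i j => by
    obtain ⟨hi, hle⟩ := integrable_exp_sq_of_moments (hz i j)
      (v := 2 * Real.exp 1 * K ^ 2) (by positivity)
      (lintegral_pow_le_of_subgaussianNorm_le hK.le (hψ i j))
    exact hasSubgaussianMGF_of_exp_sq (hz i j) ((hL2 i j).integrable (by norm_num)) (h0 i j)
      hη₀pos hi hle
  have hYsub : ∀ j, HasSubgaussianMGF (Y j) (3 / η₀) P := fun j => by
    let b : Fin n → NNReal := fun i => ⟨a i ^ 2, sq_nonneg (a i)⟩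
    have hb : ∑ i, b i * (3 / η₀) = 3 / η₀ := by
      have h : ∑ i, b i = 1 := by
        rw [← NNReal.coe_inj, NNReal.coe_sum]; exact hsum
      rw [← Finset.sum_mul, h, one_mul]
    have : HasSubgaussianMGF (Y j) (∑ i, b i * (3 / η₀)) P :=
      HasSubgaussianMGF.sum_of_iIndepFun (hcolm j) (s := Finset.univ)
        fun i _ => (hzsub i j).const_mul (a i)
    rwa [hb] at this
  set c : NNReal := 3 / η₀
  have hc : 0 < c := by positivity
  have hcc : (c : ℝ) = 12 * Real.exp 1 * K ^ 2 := by
    simp only [c]; push_cast; rw [hη₀c]; field_simp; ring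
  have hYexp := fun j => integrable_exp_sq_of_moments (hYm j) (v := Real.exp 1 * c)
    (mul_pos (Real.exp_pos _) hc) (lintegral_pow_le_of_hasSubgaussianMGF hc (hYsub j))
  have key := measureReal_abs_sum_sq_sub_one_le hYm hYi (fun j => (hYL2 j).integrable_sq) hY1
    (η := (2 * (Real.exp 1 * c))⁻¹) (by have : (0 : ℝ) < c := hc; positivity)
    (fun j => (hYexp j).1) (fun j => (hYexp j).2) hε
  have hconst : 12 / (2 * (Real.exp 1 * (c : ℝ)))⁻¹ = 288 * Real.exp 1 ^ 2 * K ^ 2 := by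
    rw [hcc, div_inv_eq_mul]; ring
  rw [hconst] at key
  exact key

-- Union bound over the net, applied to the form of `Z Zᵀ - d`. Passing from the net to all vectors
-- doubles `288` to `576`; the factor `e^{2n}` from counting is paid by `2dε² ≥ 2n + 2t²`.
open Matrix in
theorem measureReal_exists_quadraticForm_deviation_le {n d : ℕ} (hn : 0 < n) (hnd : n ≤ d)
    {z : Fin n → Fin d → Ω → ℝ} (hz : ∀ i j, Measurable (z i j))
    (hind : iIndepFun (fun (p : Fin n × Fin d) ω => z p.1 p.2 ω) P)
    (hL2 : ∀ i j, MemLp (z i j) 2 P) (h0 : ∀ i j, ∫ ω, z i j ω ∂P = 0)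
    (h1 : ∀ i j, variance (z i j) P = 1) {K : ℝ} (hK : 0 < K)
    (hψ : ∀ i j, subgaussianNorm (z i j) P ≤ ENNReal.ofReal K) {t ε : ℝ} (ht : 0 ≤ t)
    (hε : ε = Real.sqrt ((n : ℝ) / d) + t / Real.sqrt d) :
    P.real {ω | ¬ ∀ a : Fin n → ℝ, |∑ j, (∑ i, a i * z i j ω) ^ 2 - d * (a ⬝ᵥ a)| ≤
        d * (576 * Real.exp 1 ^ 2 * K ^ 2 * max ε (ε ^ 2)) * (a ⬝ᵥ a)} ≤
      2 * Real.exp (-t ^ 2) := by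
  obtain ⟨N, hNc, hN1, hN⟩ := exists_sphere_net n
  have hd : (0 : ℝ) < d := by exact_mod_cast hn.trans_le hnd
  have hε0 : 0 ≤ ε := by rw [hε]; positivity
  have hdε : n + t ^ 2 ≤ d * ε ^ 2 := by
    have h2 : Real.sqrt d * ε = Real.sqrt n + t := by
      rw [hε, Real.sqrt_div (Nat.cast_nonneg n)]
      have : Real.sqrt d ≠ 0 := (Real.sqrt_pos.2 hd).ne'
      field_simp
    have h3 : d * ε ^ 2 = (Real.sqrt n + t) ^ 2 := by
      rw [← h2, mul_pow, Real.sq_sqrt hd.le]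
    rw [h3, add_sq, Real.sq_sqrt (Nat.cast_nonneg n)]
    have : 0 ≤ 2 * Real.sqrt n * t := by positivity
    linarith
  set δ := d * (288 * Real.exp 1 ^ 2 * K ^ 2 * max ε (ε ^ 2)) with hδ
  have hsub : {ω | ¬ ∀ a : Fin n → ℝ, |∑ j, (∑ i, a i * z i j ω) ^ 2 - d * (a ⬝ᵥ a)| ≤
        d * (576 * Real.exp 1 ^ 2 * K ^ 2 * max ε (ε ^ 2)) * (a ⬝ᵥ a)} ⊆
      ⋃ y ∈ N, {ω | δ ≤ |∑ j, ((∑ i, y i * z i j ω) ^ 2 - 1)|} := by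
    intro ω hω
    by_contra hcon
    simp only [Set.mem_iUnion, Set.mem_ofPred_eq, exists_prop, not_exists, not_and, not_le] at hcon
    refine hω fun a => ?_
    let Z : Matrix (Fin n) (Fin d) ℝ := of fun i j => z i j ω
    let B : Matrix (Fin n) (Fin n) ℝ := Z * Zᵀ - (d : ℝ) • 1
    have hB : B.IsHermitian := by
      simp [B, Matrix.IsHermitian, conjTranspose_eq_transpose_of_trivial]
    have hq : ∀ y : Fin n → ℝ,
        y ⬝ᵥ B *ᵥ y = ∑ j, (∑ i, y i * z i j ω) ^ 2 - d * (y ⬝ᵥ y) := by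
      intro y
      rw [sub_mulVec, dotProduct_sub, smul_mulVec, one_mulVec, dotProduct_smul, smul_eq_mul,
        ← mulVec_mulVec, dotProduct_mulVec, mulVec_transpose]
      congr 1
      simp [dotProduct, vecMul, Z, sq]
    have := abs_quadraticForm_le_of_net hB (N := N) hN1 hN (δ := δ) (fun y hy => by
      have := (hcon y hy).le
      rw [hq, hN1 y hy]
      simpa [Finset.sum_sub_distrib] using this) a
    rw [hq] at this
    refine this.trans (le_of_eq ?_)
    rw [hδ]; ring
  have h5 : (5 : ℝ) ≤ Real.exp 2 := by
    have := Real.exp_one_gt_d9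
    have e2 : Real.exp 2 = Real.exp 1 * Real.exp 1 := by rw [← Real.exp_add]; norm_num
    rw [e2]; nlinarith
  calc _ ≤ P.real (⋃ y ∈ N, {ω | δ ≤ |∑ j, ((∑ i, y i * z i j ω) ^ 2 - 1)|}) :=
        measureReal_mono hsub (measure_ne_top _ _)
    _ ≤ ∑ y ∈ N, P.real {ω | δ ≤ |∑ j, ((∑ i, y i * z i j ω) ^ 2 - 1)|} :=
        measureReal_biUnion_finset_le _ _
    _ ≤ ∑ y ∈ N, 2 * Real.exp (-(2 * (d * ε ^ 2))) := Finset.sum_le_sum fun y hy =>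
        measureReal_abs_sum_sq_linearCombination_le hz hind hL2 h0 h1 hK hψ (hN1 y hy) hε0
    _ = N.card * (2 * Real.exp (-(2 * (d * ε ^ 2)))) := by simp
    _ ≤ Real.exp (n * 2) * (2 * Real.exp (-(2 * (d * ε ^ 2)))) := by
        refine mul_le_mul_of_nonneg_right ?_ (by positivity)
        calc (N.card : ℝ) ≤ 5 ^ n := by exact_mod_cast hNc
          _ ≤ Real.exp 2 ^ n := by gcongr
          _ = Real.exp (n * 2) := by rw [Real.exp_nat_mul]
    _ = 2 * Real.exp (n * 2 + -(2 * (d * ε ^ 2))) := by rw [Real.exp_add]; ring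
    _ ≤ 2 * Real.exp (-t ^ 2) := by
        have : n * 2 + -(2 * (d * ε ^ 2)) ≤ -t ^ 2 := by nlinarith [sq_nonneg t]
        gcongr

end Concentration

/-! ### From near-isometry to eigenvalue bounds. -/

theorem sortedEigenvalue_nonneg {d : ℕ} {A : Matrix (Fin d) (Fin d) ℝ} (hA : A.PosSemidef)
    (i : Fin d) : 0 ≤ sortedEigenvalue hA.isHermitian i := by
  have := hA.eigenvalues_nonneg ((Fintype.equivOfCardEq (Fintype.card_fin _))
    (Fin.cast (Fintype.card_fin d).symm i))
  simpa [Matrix.IsHermitian.eigenvalues, sortedEigenvalue] using this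

theorem dotProduct_sq_le {m : ℕ} (u v : Fin m → ℝ) :
    (u ⬝ᵥ v) ^ 2 ≤ (u ⬝ᵥ u) * (v ⬝ᵥ v) := by
  simpa [dotProduct, ← sq] using Finset.sum_mul_sq_le_sq_mul_sq Finset.univ u v

open Matrix in
/-- Near-isometry of `Zᵀ` gives relative bounds for the eigenvalues of `(Z S)ᵀ (Z S)`. -/
theorem sortedEigenvalue_bounds_of_near_isometry {n d : ℕ} (hn : 0 < n) (hnd : n ≤ d)
    {S G H : Matrix (Fin d) (Fin d) ℝ} (hS : Sᵀ = S) (hSu : IsUnit S) (hG : G.IsHermitian)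
    (hGS : G = S * S) (hH : H.IsHermitian) {Z : Matrix (Fin n) (Fin d) ℝ}
    (hHZ : H = (1 / (n : ℝ)) • ((Z * S)ᵀ * (Z * S))) {r : ℝ} (hr : 0 ≤ r)
    (hZ : ∀ a : Fin n → ℝ, |(Zᵀ *ᵥ a) ⬝ᵥ (Zᵀ *ᵥ a) - d * (a ⬝ᵥ a)| ≤ d * r * (a ⬝ᵥ a))
    (i : Fin n) (hi : (i : ℕ) + (d - n) < d) :
    sortedEigenvalue hG ⟨i + (d - n), hi⟩ * (1 - r) ≤
        (n : ℝ) / d * sortedEigenvalue hH (Fin.castLE hnd i) ∧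
      (n : ℝ) / d * sortedEigenvalue hH (Fin.castLE hnd i) ≤
        sortedEigenvalue hG (Fin.castLE hnd i) * (1 + r) := by
  have hn' : (0 : ℝ) < n := by exact_mod_cast hn
  have hd' : (0 : ℝ) < d := by exact_mod_cast hn.trans_le hnd
  have hnn : ∀ {m : ℕ} (u : Fin m → ℝ), 0 ≤ u ⬝ᵥ u := fun u => by
    simpa using dotProduct_star_self_nonneg u
  have hqG : ∀ u, u ⬝ᵥ G *ᵥ u = (S *ᵥ u) ⬝ᵥ (S *ᵥ u) := fun u => by
    rw [hGS, ← mulVec_mulVec, dotProduct_mulVec, ← mulVec_transpose, hS]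
  have hqH : ∀ u, (n : ℝ) / d * (u ⬝ᵥ H *ᵥ u) =
      1 / d * ((Z *ᵥ (S *ᵥ u)) ⬝ᵥ (Z *ᵥ (S *ᵥ u))) := fun u => by
    rw [hHZ, smul_mulVec, dotProduct_smul, ← mulVec_mulVec, dotProduct_mulVec u,
      ← mulVec_transpose, transpose_transpose, mulVec_mulVec, smul_eq_mul]
    field_simp
  have hadj : ∀ (u : Fin d → ℝ) (a : Fin n → ℝ), u ⬝ᵥ (Zᵀ *ᵥ a) = (Z *ᵥ u) ⬝ᵥ a := fun u a => by
    rw [dotProduct_mulVec, ← mulVec_transpose, transpose_transpose]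
  have hup : ∀ a, (Zᵀ *ᵥ a) ⬝ᵥ (Zᵀ *ᵥ a) ≤ d * (1 + r) * (a ⬝ᵥ a) := fun a => by
    linarith [(abs_le.1 (hZ a)).2]
  have hlo : ∀ a, d * (1 - r) * (a ⬝ᵥ a) ≤ (Zᵀ *ᵥ a) ⬝ᵥ (Zᵀ *ᵥ a) := fun a => by
    linarith [(abs_le.1 (hZ a)).1]
  constructor
  -- If `r ≥ 1` the lower bound is trivial by signs; otherwise `Zᵀ` is injective, which the subspace
  -- argument needs.
  · rcases le_or_gt (1 - r) 0 with hr1 | hr1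
    · have hGp : G.PosSemidef := by
        have := posSemidef_conjTranspose_mul_self S
        rwa [conjTranspose_eq_transpose_of_trivial, hS, ← hGS] at this
      have hHp : H.PosSemidef := by
        have := (posSemidef_conjTranspose_mul_self (Z * S)).smul (a := 1 / (n : ℝ)) (by positivity)
        rwa [conjTranspose_eq_transpose_of_trivial, ← hHZ] at this
      exact (mul_nonpos_of_nonneg_of_nonpos (sortedEigenvalue_nonneg hGp _) hr1).trans
        (mul_nonneg (by positivity) (sortedEigenvalue_nonneg hHp _))
    · have hSS : ∀ w, S *ᵥ (S⁻¹ *ᵥ w) = w := fun w => by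
        rw [mulVec_mulVec, mul_nonsing_inv _ ((isUnit_iff_isUnit_det S).1 hSu), one_mulVec]
      let L : (Fin n → ℝ) →ₗ[ℝ] (Fin d → ℝ) := S⁻¹.mulVecLin ∘ₗ Zᵀ.mulVecLin
      have hLa : ∀ a, S *ᵥ L a = Zᵀ *ᵥ a := fun a => hSS _
      have hL : Function.Injective L := by
        refine (injective_iff_map_eq_zero L).2 fun a ha => ?_
        have h1 := hlo a
        rw [← hLa, ha, mulVec_zero, zero_dotProduct] at h1
        have h2 : a ⬝ᵥ a ≤ 0 := by
          by_contra! h3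
          have : 0 < d * (1 - r) * (a ⬝ᵥ a) := by positivity
          linarith
        exact dotProduct_self_eq_zero.1 (le_antisymm h2 (hnn a))
      -- With `w = Zᵀa`, Cauchy-Schwarz gives `‖w‖⁴ = ⟨Zw, a⟩² ≤ ‖Zw‖² ‖a‖²`, and `d(1-r)‖a‖² ≤
      -- ‖w‖²` yields `d(1-r)‖w‖² ≤ ‖Zw‖²`.
      have := sortedEigenvalue_le_of_quadraticForm_le hnd hH hG L hL hr1.le
        (e := (n : ℝ) / d) (by positivity) (fun a => by
          rw [hqG, hqH, hLa]
          set w := Zᵀ *ᵥ a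
          have h1 : w ⬝ᵥ w = (Z *ᵥ w) ⬝ᵥ a := hadj w a
          have h2 := dotProduct_sq_le (Z *ᵥ w) a
          rw [← h1] at h2
          have h3 := hlo a
          change _ ≤ w ⬝ᵥ w at h3
          have hw := hnn w
          rcases hw.eq_or_lt with hw0 | hw0
          · rw [← hw0, mul_zero]
            have := hnn (Z *ᵥ w)
            positivity
          · rw [one_div, inv_mul_eq_div, le_div_iff₀ hd']
            have h4 := mul_le_mul_of_nonneg_left h3 (hnn (Z *ᵥ w))
            have h5 : d * (1 - r) * (w ⬝ᵥ w) ^ 2 ≤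
                d * (1 - r) * (((Z *ᵥ w) ⬝ᵥ (Z *ᵥ w)) * (a ⬝ᵥ a)) :=
              mul_le_mul_of_nonneg_left h2 (by positivity)
            refine le_of_mul_le_mul_right ?_ hw0
            linarith) i hi
      linarith
  -- The whole space serves as subspace, so the shift is `d - d = 0`. The form bound is `‖Z‖ = ‖Zᵀ‖`
  -- in disguise: `‖Zw‖⁴ = ⟨w, ZᵀZw⟩² ≤ ‖w‖² · d(1+r)‖Zw‖²`.
  · have := sortedEigenvalue_le_of_quadraticForm_le le_rfl hG hH LinearMap.id
      (fun _ _ h => h) (c := (n : ℝ) / d) (e := 1 + r) (by positivity) (by positivity) (fun u => by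
        simp only [LinearMap.id_apply]
        rw [hqG, hqH]
        set w := S *ᵥ u
        have h1 := hadj w (Z *ᵥ w)
        have h2 := dotProduct_sq_le w (Zᵀ *ᵥ (Z *ᵥ w))
        rw [h1] at h2
        have h3 := hup (Z *ᵥ w)
        rcases (hnn (Z *ᵥ w)).eq_or_lt with h0 | h0
        · rw [← h0, mul_zero]
          have := hnn w
          positivity
        · rw [one_div, inv_mul_eq_div, div_le_iff₀ hd']
          have h4 := mul_le_mul_of_nonneg_left h3 (hnn w)
          refine le_of_mul_le_mul_right ?_ h0
          linarith) (Fin.castLE hnd i) (by simp; omega)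
    simp only [Fin.val_castLE, Nat.sub_self, add_zero, Fin.castLE_rfl] at this
    rw [mul_comm (sortedEigenvalue hG _)]
    exact this

/-! ### The population matrix and the final assembly. -/

open Matrix in
theorem populationCov_posSemidef {Ω : Type*} [MeasurableSpace Ω] {P : Measure Ω} {n d : ℕ}
    {x : Fin n → Ω → Fin d → ℝ} (hx : ∀ i j, MemLp (fun ω => x i ω j) 2 P) :
    (populationCov x P).PosSemidef := by
  have hint : ∀ j k, Integrable (fun ω => empiricalCov x ω j k) P := by
    intro j k
    simp only [empiricalCov, dataMatrix, Matrix.smul_apply, mul_apply, transpose_apply, of_apply,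
      smul_eq_mul]
    exact (integrable_finsetSum _ fun i _ => (hx i j).integrable_mul (hx i k)).const_mul _
  refine PosSemidef.of_dotProduct_mulVec_nonneg (populationCov_isHermitian x P) fun v => ?_
  have h1 : star v ⬝ᵥ populationCov x P *ᵥ v = ∫ ω, v ⬝ᵥ empiricalCov x ω *ᵥ v ∂P := by
    simp only [dotProduct, mulVec, populationCov, of_apply, star_trivial]
    rw [integral_finsetSum _ fun j _ => (integrable_finsetSum _ fun k _ =>
      (hint j k).mul_const _).const_mul _]
    refine Finset.sum_congr rfl fun j _ => ?_
    rw [integral_const_mul, integral_finsetSum _ fun k _ => (hint j k).mul_const _]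
    simp only [integral_mul_const]
  rw [h1]
  refine integral_nonneg fun ω => ?_
  have : (empiricalCov x ω).PosSemidef := by
    have := (posSemidef_conjTranspose_mul_self (dataMatrix x ω)).smul (a := 1 / (n : ℝ))
      (by positivity)
    rwa [conjTranspose_eq_transpose_of_trivial] at this
  simpa using this.dotProduct_mulVec_nonneg v

/-- `ENNReal.ofReal` sends `K ≤ 0` to `0`; the `p = 1` term would then force `Y = 0` almost
everywhere, against nonzero variance. -/
theorem pos_of_subgaussianNorm_le {Ω : Type*} [MeasurableSpace Ω] {P : Measure Ω}
    [IsProbabilityMeasure P] {Y : Ω → ℝ} (hY : MemLp Y 2 P) (hv : variance Y P ≠ 0) {K : ℝ}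
    (h : subgaussianNorm Y P ≤ ENNReal.ofReal K) : 0 < K := by
  by_contra! hK
  rw [ENNReal.ofReal_of_nonpos hK, nonpos_iff_eq_zero] at h
  have h1 : eLpNorm Y (ENNReal.ofReal 1) P / ENNReal.ofReal (Real.sqrt 1) ≤ 0 := by
    rw [← h]
    exact le_iSup₂ (f := fun (p : ℝ) (_ : 1 ≤ p) =>
      eLpNorm Y (ENNReal.ofReal p) P / ENNReal.ofReal (Real.sqrt p)) 1 le_rfl
  have h2 : eLpNorm Y 1 P = 0 := by simpa using h1
  rw [eLpNorm_eq_zero_iff hY.1 (by simp)] at h2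
  exact hv (by rw [variance_congr h2]; simp)

open Matrix in
theorem mainTheorem6 :
    ∃ C : ℝ, 0 < C ∧
      ∀ (Ω : Type*) [MeasurableSpace Ω] (P : Measure Ω) [IsProbabilityMeasure P]
        (n d : ℕ) (hnd : n ≤ d) (x : Fin n → Ω → Fin d → ℝ) (K t : ℝ),
        -- the rows are i.i.d. random vectors with finite second moments
        (∀ i, Measurable (x i)) →
        iIndepFun x P →
        (∀ i i', IdentDistrib (x i) (x i') P P) →
        (∀ i j, MemLp (fun ω => x i ω j) 2 P) →
        -- the second-moment matrix is invertible
        IsUnit (populationCov x P) →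
        -- the rows are mean-zero
        (∀ i j, ∫ ω, x i ω j ∂P = 0) →
        -- the whitened entries are independent, of unit variance and sub-gaussian
        iIndepFun (fun (ij : Fin n × Fin d) ω => whitened x P ij.1 ω ij.2) P →
        (∀ i j, variance (fun ω => whitened x P i ω j) P = 1) →
        (∀ i j, subgaussianNorm (fun ω => whitened x P i ω j) P ≤ ENNReal.ofReal K) →
        0 ≤ t →
        let ε : ℝ := Real.sqrt ((n : ℝ) / d) + t / Real.sqrt d
        1 - 2 * Real.exp (-t ^ 2) ≤ P.real {ω | ∀ i : Fin n,
          sortedEigenvalue (populationCov_isHermitian x P)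
              ⟨(i : ℕ) + (d - n), by have := i.isLt; omega⟩ *
              (1 - C * K ^ 2 * max ε (ε ^ 2))
            ≤ (n : ℝ) / d * sortedEigenvalue (empiricalCov_isHermitian x ω) (Fin.castLE hnd i) ∧
          (n : ℝ) / d * sortedEigenvalue (empiricalCov_isHermitian x ω) (Fin.castLE hnd i)
            ≤ sortedEigenvalue (populationCov_isHermitian x P) (Fin.castLE hnd i) *
              (1 + C * K ^ 2 * max ε (ε ^ 2))} := by
  refine ⟨576 * Real.exp 1 ^ 2, by positivity, ?_⟩
  intro Ω _ P _ n d hnd x K t hxm _ _ hxL2 hunit hx0 hzind hzvar hzψ ht ε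
  rcases Nat.eq_zero_or_pos n with rfl | hn
  · simp only [IsEmpty.forall_iff, Set.ofPred_true, probReal_univ]
    linarith [Real.exp_pos (-t ^ 2)]
  have hpsd := populationCov_posSemidef hxL2
  set S := CFC.sqrt (populationCov x P) with hSdef
  have hSS : S * S = populationCov x P := CFC.sqrt_mul_sqrt_self _ hpsd.nonneg
  have hST : Sᵀ = S := by
    have := (CFC.sqrt_nonneg (populationCov x P)).posSemidef.isHermitian
    rwa [Matrix.IsHermitian, conjTranspose_eq_transpose_of_trivial] at this
  have hSu : IsUnit S := (CFC.isUnit_sqrt_iff _ hpsd.nonneg).2 hunit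
  have hwh : ∀ i j ω, whitened x P i ω j = ∑ k, S⁻¹ j k * x i ω k := fun _ _ _ => rfl
  set z : Fin n → Fin d → Ω → ℝ := fun i j ω => whitened x P i ω j with hzdef
  have hxm' : ∀ i k, Measurable fun ω => x i ω k := fun i k => (measurable_pi_apply k).comp (hxm i)
  have hzm : ∀ i j, Measurable (z i j) := fun i j => by
    simp only [hzdef, hwh]; fun_prop
  have hzL2 : ∀ i j, MemLp (z i j) 2 P := fun i j => by
    simp only [hzdef, hwh]
    exact memLp_finsetSum _ fun k _ => (hxL2 i k).const_mul _
  have hz0 : ∀ i j, ∫ ω, z i j ω ∂P = 0 := fun i j => by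
    simp only [hzdef, hwh]
    rw [integral_finsetSum _ fun k _ => ((hxL2 i k).integrable (by norm_num)).const_mul _]
    simp [integral_const_mul, hx0]
  have hK : 0 < K := pos_of_subgaussianNorm_le (hzL2 ⟨0, hn⟩ ⟨0, hn.trans_le hnd⟩)
    (by rw [hzvar]; norm_num) (hzψ _ _)
  have hbad := measureReal_exists_quadraticForm_deviation_le hn hnd hzm hzind hzL2 hz0 hzvar hK hzψ
    ht (ε := ε) rfl
  have hε0 : 0 ≤ ε := by positivity
  set r := 576 * Real.exp 1 ^ 2 * K ^ 2 * max ε (ε ^ 2)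
  have hr : 0 ≤ r := mul_nonneg (by positivity) (le_max_of_le_left hε0)
  set good : Set Ω := {ω | ∀ a : Fin n → ℝ,
    |∑ j, (∑ i, a i * z i j ω) ^ 2 - d * (a ⬝ᵥ a)| ≤ d * r * (a ⬝ᵥ a)}
  -- Subadditivity alone is used, so measurability of `good` is not needed.
  have hcompl : 1 ≤ P.real good + P.real goodᶜ := by
    rw [← probReal_univ (μ := P), ← Set.union_compl_self good]
    exact measureReal_union_le _ _
  calc 1 - 2 * Real.exp (-t ^ 2) ≤ P.real good := by
        change P.real goodᶜ ≤ _ at hbad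
        linarith
    _ ≤ _ := by
        refine measureReal_mono (fun ω hω i => ?_) (measure_ne_top _ _)
        let Z : Matrix (Fin n) (Fin d) ℝ := of fun i j => z i j ω
        have hX : dataMatrix x ω = Z * S := by
          have hrow : ∀ i, S *ᵥ whitened x P i ω = x i ω := fun i => by
            rw [whitened, mulVec_mulVec, mul_nonsing_inv _ ((isUnit_iff_isUnit_det S).1 hSu),
              one_mulVec]
          ext i k
          rw [← hST]
          change x i ω k = _
          rw [← hrow i]
          simp [mul_apply, mulVec, dotProduct, Z, z, mul_comm]
        exact sortedEigenvalue_bounds_of_near_isometry hn hnd hST hSu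
          (populationCov_isHermitian x P) hSS.symm (empiricalCov_isHermitian x ω) (Z := Z)
          (by rw [empiricalCov, hX]) hr (fun a => by
            have := hω a
            simpa [dotProduct, mulVec, Z, ← sq, mul_comm] using this) i
          (by have := i.isLt; omega)
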